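/- Let $\mathcal{E}$ be a countable set of exception names. The calculus $F_x$ over $\mathcal{E}$ is the following. \textbf{Terms} (up to $\alpha$-equivalence): $M,N ::= x \mid \lambda x.M \mid M\,N \mid \mathsf{raise}\,\varepsilon \mid \mathsf{try}\ M\ \mathsf{with}\ \varepsilon\mapsto N \mid 0 \mid S \mid \mathsf{natrec} \mid \mathsf{nil} \mid \mathsf{cons} \mid \mathsf{foldright}$, where $\varepsilon\in\mathcal{E}$ and $\mathsf{try}$ binds nothing. A \emph{regular value} is a closed term of one of the forms $\lambda x.M$, $0$, $S$, $S\,N$, $\mathsf{natrec}$, $\mathsf{natrec}\,M$, $\mathsf{natrec}\,M\,N$, $\mathsf{nil}$, $\mathsf{cons}$, $\mathsf{cons}\,M$, $\mathsf{cons}\,M\,N$, $\mathsf{foldright}$, $\mathsf{foldright}\,M$, $\mathsf{foldright}\,M\,N$. A \emph{value} is a regular value or an exception $\mathsf{raise}\,\varepsilon$. \textbf{Reduction.} $\to$ is the closure of the following rules under all term constructions (any subterm may be reduced, also under $\lambda$, in arguments and in handlers), and $\to^*$ is its reflexive transitive closure: $(\lambda x.M)\,N \to M[x:=N]$; $(\mathsf{raise}\,\varepsilon)\,M\to\mathsf{raise}\,\varepsilon$;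 $\mathsf{try}\ \mathsf{raise}\,\varepsilon\ \mathsf{with}\ \varepsilon\mapsto N\to N$; $\mathsf{try}\ \mathsf{raise}\,\varepsilon'\ \mathsf{with}\ \varepsilon\mapsto N\to \mathsf{raise}\,\varepsilon'$ if $\varepsilon\ne\varepsilon'$; $\mathsf{try}\ V\ \mathsf{with}\ \varepsilon\mapsto N\to V$ if $V$ is a regular value; $\mathsf{natrec}\,X\,Y\,0\to X$; $\mathsf{natrec}\,X\,Y\,(S\,N)\to Y\,N\,(\mathsf{natrec}\,X\,Y\,N)$; $\mathsf{natrec}\,X\,Y\,(\mathsf{raise}\,\varepsilon)\to\mathsf{raise}\,\varepsilon$; $\mathsf{foldright}\,X\,Y\,\mathsf{nil}\to X$; $\mathsf{foldright}\,X\,Y\,(\mathsf{cons}\,H\,L)\to Y\,H\,L\,(\mathsf{foldright}\,X\,Y\,L)$; $\mathsf{foldright}\,X\,Y\,(\mathsf{raise}\,\varepsilon)\to\mathsf{raise}\,\varepsilon$. \textbf{Types} (up to $\alpha$-equivalence): $A,B::=\alpha\mid \mathsf{nat}\mid\mathsf{list}\,A\mid A\to B\mid\forall\alpha.A\mid A\uplus\Delta\mid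 A^{\Delta}$, with $\Delta$ a finite subset of $\mathcal{E}$ ($A\uplus\Delta$ is the union type, $A^\Delta$ the corruption type). \textbf{Subtyping} $\le$ is the least reflexive transitive relation such that (with $A\simeq B$ meaning both $A\le B$ and $B\le A$): if $A'\le A$ and $B\le B'$ then $A\to B\le A'\to B'$; if $A\le B$ and $\alpha\notin FV(A)$ then $A\le\forall\alpha.B$; $\forall\alpha.A\le A[\alpha:=B]$; $\forall\alpha.(A\to B)\le A\to\forall\alpha.B$ if $\alpha\notin FV(A)$; $A\le A\uplus\Delta\le A^\Delta$; $A^\emptyset\le A$; if $A\le B$ then $A\uplus\Delta\le B\uplus\Delta$ and $\mathsf{list}\,A\le\mathsf{list}\,B$; $(A\to B)\uplus\Delta\le A\to(B\uplus\Delta)$; $\forall\alpha.A^\Delta\le(\forall\alpha.A)^\Delta$; $\forall\alpha.(A\uplus\Delta)\le(\forall\alpha.A)\uplus\Delta$; $\mathsf{list}\,(A^\Delta)\le(\mathsf{list}\,A)^\Delta$; $(A\uplus\Delta)\uplus\Delta'\simeq A\uplus(\Delta\cup\Delta')$; $(A^\Delta)^{\Delta'}\simeq A^{\Delta\cup\Delta'}$;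 $(A\uplus\Delta)^{\Delta'}\simeq A^{\Delta'}\uplus\Delta$; $(A\to B)^\Delta\simeq A^\Delta\to B^\Delta$. \textbf{Typing.} A typing context $\Gamma$ is a finite set of declarations $x_i:A_i$ with distinct $x_i$. The judgment $\Gamma\vdash M:A$ is inductively generated by: $\Gamma\vdash x:A$ if $(x:A)\in\Gamma$; if $\Gamma,x:A\vdash M:B$ then $\Gamma\vdash\lambda x.M:A\to B$; if $\Gamma\vdash M:A\to B$ and $\Gamma\vdash N:A$ then $\Gamma\vdash M\,N:B$; if $\Gamma\vdash M:A$ and $\alpha\notin FV(\Gamma)$ then $\Gamma\vdash M:\forall\alpha.A$; if $\Gamma\vdash M:A$ and $A\le B$ then $\Gamma\vdash M:B$; $\Gamma\vdash0:\mathsf{nat}$; $\Gamma\vdash S:\mathsf{nat}\to\mathsf{nat}$; $\Gamma\vdash\mathsf{natrec}:\forall\alpha.\,\alpha\uplus\Delta\to(\mathsf{nat}^\Delta\to\alpha\uplus\Delta\to\alpha\uplus\Delta)\to\mathsf{nat}^\Delta\uplus\Delta'\to\alpha\uplus(\Delta\cup\Delta')$; $\Gamma\vdash\mathsf{nil}:\forall\alpha.\,\mathsf{list}\,\alpha$;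 $\Gamma\vdash\mathsf{cons}:\forall\alpha.\,\alpha\to\mathsf{list}\,\alpha\to\mathsf{list}\,\alpha$; $\Gamma\vdash\mathsf{foldright}:\forall\alpha.\forall\beta.\,\alpha\uplus\Delta\to(\beta^\Delta\to(\mathsf{list}\,\beta)^\Delta\to\alpha\uplus\Delta\to\alpha\uplus\Delta)\to(\mathsf{list}\,\beta)^\Delta\uplus\Delta'\to\alpha\uplus(\Delta\cup\Delta')$; $\Gamma\vdash\mathsf{raise}\,\varepsilon:\forall\alpha.\,\alpha\uplus\{\varepsilon\}$; if $\Gamma\vdash M:A\uplus\{\varepsilon\}$ and $\Gamma\vdash N:A$ then $\Gamma\vdash\mathsf{try}\ M\ \mathsf{with}\ \varepsilon\mapsto N:A$. Here $\Delta,\Delta'$ are arbitrary finite sets of exception names. \textbf{Theorem (weak head normalization).} If $M$ is a closed term, $A$ a type and $\Gamma$ a typing context such that $\Gamma\vdash M:A$, then $M$ has a value: there is a value $V$ (a regular value or an exception) with $M\to^*V$. -/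

import Mathlib

namespace Fx

universe u

/-! ### Terms

Terms and types are taken up to renaming of bound variables, so both are written with de Bruijn
indices. `E` is the set of exception names. -/

/-- The terms of Fx over the exception names `E`. -/
inductive Term (E : Type u) : Type u where
  | var (n : ℕ) : Term E
  | lam (M : Term E) : Term E
  | app (M N : Term E) : Term E
  /-- The exception `raise ε`. -/
  | raise (ε : E) : Term E
  /-- The handler `try M with ε ↦ N`. -/
  | tryWith (M : Term E) (ε : E) (N : Term E) : Term E
  | zero : Term E
  | succ : Term E
  | natrec : Term E
  | nil : Term E
  | cons : Term E
  | foldright : Term E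

/-- The extension of a renaming of variables under one binder. -/
def upRen (ξ : ℕ → ℕ) : ℕ → ℕ
  | 0 => 0
  | n + 1 => ξ n + 1

namespace Term

variable {E : Type u}

/-- Renaming of the free variables of a term. -/
def rename : (ℕ → ℕ) → Term E → Term E
  | ξ, var n => var (ξ n)
  | ξ, lam M => lam (M.rename (upRen ξ))
  | ξ, app M N => app (M.rename ξ) (N.rename ξ)
  | _, raise ε => raise ε
  | ξ, tryWith M ε N => tryWith (M.rename ξ) ε (N.rename ξ)
  | _, zero => zero
  | _, succ => succ
  | _, natrec => natrec
  | _, nil => nil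
  | _, cons => cons
  | _, foldright => foldright

/-- The extension of a parallel substitution under one binder. -/
def up (σ : ℕ → Term E) : ℕ → Term E
  | 0 => var 0
  | n + 1 => (σ n).rename Nat.succ

/-- Parallel capture-avoiding substitution. -/
def subst : (ℕ → Term E) → Term E → Term E
  | σ, var n => σ n
  | σ, lam M => lam (M.subst (up σ))
  | σ, app M N => app (M.subst σ) (N.subst σ)
  | _, raise ε => raise ε
  | σ, tryWith M ε N => tryWith (M.subst σ) ε (N.subst σ)
  | _, zero => zero
  | _, succ => succ
  | _, natrec => natrec
  | _, nil => nil
  | _, cons => cons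
  | _, foldright => foldright

/-- `M.inst N` is `M[x := N]`, where `x` is the outermost variable (index `0`) of `M`; the
remaining free variables are lowered by one. -/
def inst (M N : Term E) : Term E :=
  M.subst fun n => match n with
    | 0 => N
    | n + 1 => var n

/-- Every free variable of the term has index less than the given number. -/
def ClosedAt : ℕ → Term E → Prop
  | k, var n => n < k
  | k, lam M => M.ClosedAt (k + 1)
  | k, app M N => M.ClosedAt k ∧ N.ClosedAt k
  | _, raise _ => True
  | k, tryWith M _ N => M.ClosedAt k ∧ N.ClosedAt k
  | _, zero => True
  | _, succ => True
  | _, natrec => True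
  | _, nil => True
  | _, cons => True
  | _, foldright => True

/-- The term has no free variable. -/
def Closed (M : Term E) : Prop := M.ClosedAt 0

/-- The shapes of regular values. -/
inductive RegularShape : Term E → Prop where
  | lam (M : Term E) : RegularShape (lam M)
  | zero : RegularShape zero
  | succ : RegularShape succ
  | succ₁ (N : Term E) : RegularShape (app succ N)
  | natrec : RegularShape natrec
  | natrec₁ (M : Term E) : RegularShape (app natrec M)
  | natrec₂ (M N : Term E) : RegularShape (app (app natrec M) N)
  | nil : RegularShape nil
  | cons : RegularShape cons
  | cons₁ (M : Term E) : RegularShape (app cons M)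
  | cons₂ (M N : Term E) : RegularShape (app (app cons M) N)
  | foldright : RegularShape foldright
  | foldright₁ (M : Term E) : RegularShape (app foldright M)
  | foldright₂ (M N : Term E) : RegularShape (app (app foldright M) N)

/-- Regular values: closed terms of one of the shapes above. -/
def IsRegularValue (M : Term E) : Prop := M.Closed ∧ RegularShape M

/-- Values: regular values and exceptions. -/
def IsValue (M : Term E) : Prop := IsRegularValue M ∨ ∃ ε : E, M = raise ε

/-- The notion of reduction. -/
inductive Beta : Term E → Term E → Prop where
  | beta (M N : Term E) : Beta (app (lam M) N) (M.inst N)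
  | raise_app (ε : E) (M : Term E) : Beta (app (raise ε) M) (raise ε)
  | try_catch (ε : E) (N : Term E) : Beta (tryWith (raise ε) ε N) N
  | try_raise (ε ε' : E) (N : Term E) (h : ε ≠ ε') : Beta (tryWith (raise ε') ε N) (raise ε')
  | try_value (ε : E) (V N : Term E) (h : IsRegularValue V) : Beta (tryWith V ε N) V
  | natrec_zero (X Y : Term E) : Beta (app (app (app natrec X) Y) zero) X
  | natrec_succ (X Y N : Term E) :
      Beta (app (app (app natrec X) Y) (app succ N))
        (app (app Y N) (app (app (app natrec X) Y) N))
  | natrec_raise (X Y : Term E) (ε : E) :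
      Beta (app (app (app natrec X) Y) (raise ε)) (raise ε)
  | foldright_nil (X Y : Term E) : Beta (app (app (app foldright X) Y) nil) X
  | foldright_cons (X Y H L : Term E) :
      Beta (app (app (app foldright X) Y) (app (app cons H) L))
        (app (app (app Y H) L) (app (app (app foldright X) Y) L))
  | foldright_raise (X Y : Term E) (ε : E) :
      Beta (app (app (app foldright X) Y) (raise ε)) (raise ε)

/-- One-step reduction: the notion of reduction applied to any subterm. -/
inductive Red : Term E → Term E → Prop where
  | base {M M' : Term E} (h : Beta M M') : Red M M'
  | app_left {M M' : Term E} (N : Term E) (h : Red M M') : Red (app M N) (app M' N)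
  | app_right (M : Term E) {N N' : Term E} (h : Red N N') : Red (app M N) (app M N')
  | try_body {M M' : Term E} (ε : E) (N : Term E) (h : Red M M') :
      Red (tryWith M ε N) (tryWith M' ε N)
  | try_handler (M : Term E) (ε : E) {N N' : Term E} (h : Red N N') :
      Red (tryWith M ε N) (tryWith M ε N')
  | lam {M M' : Term E} (h : Red M M') : Red (lam M) (lam M')

/-- The reflexive and transitive closure of one-step reduction. -/
def Reduces (M N : Term E) : Prop := Relation.ReflTransGen Red M N

/-- The term reduces to a value. -/
def HasValue (M : Term E) : Prop := ∃ V : Term E, IsValue V ∧ Reduces M V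

end Term

/-! ### Types -/

/-- The types of Fx over the exception names `E`. -/
inductive Ty (E : Type u) : Type u where
  | var (n : ℕ) : Ty E
  | nat : Ty E
  | list (A : Ty E) : Ty E
  | arrow (A B : Ty E) : Ty E
  | all (A : Ty E) : Ty E
  /-- The union type `A ⊎ Δ`. -/
  | union (A : Ty E) (Δ : Finset E) : Ty E
  /-- The corruption type `A ^ Δ`. -/
  | corrupt (A : Ty E) (Δ : Finset E) : Ty E

namespace Ty

variable {E : Type u}

/-- Renaming of the free type variables of a type. -/
def rename : (ℕ → ℕ) → Ty E → Ty E
  | ξ, var n => var (ξ n)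
  | _, nat => nat
  | ξ, list A => list (A.rename ξ)
  | ξ, arrow A B => arrow (A.rename ξ) (B.rename ξ)
  | ξ, all A => all (A.rename (upRen ξ))
  | ξ, union A Δ => union (A.rename ξ) Δ
  | ξ, corrupt A Δ => corrupt (A.rename ξ) Δ

/-- Weakening: the type `A` seen in the scope of one more type variable, which is not free in
it. -/
def shift (A : Ty E) : Ty E := A.rename Nat.succ

/-- The extension of a parallel substitution under one quantifier. -/
def up (σ : ℕ → Ty E) : ℕ → Ty E
  | 0 => var 0
  | n + 1 => (σ n).shift

/-- Parallel capture-avoiding substitution. -/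
def subst : (ℕ → Ty E) → Ty E → Ty E
  | σ, var n => σ n
  | _, nat => nat
  | σ, list A => list (A.subst σ)
  | σ, arrow A B => arrow (A.subst σ) (B.subst σ)
  | σ, all A => all (A.subst (up σ))
  | σ, union A Δ => union (A.subst σ) Δ
  | σ, corrupt A Δ => corrupt (A.subst σ) Δ

/-- `A.inst B` is `A[α := B]`, where `α` is the outermost type variable (index `0`) of `A`. -/
def inst (A B : Ty E) : Ty E :=
  A.subst fun n => match n with
    | 0 => B
    | n + 1 => var n

end Ty

open Ty in
/-- The subtyping relation. A side condition `α ∉ FV(A)` on a quantified variable `α` is expressed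
by `A.shift`; each equality rule gives two rules. -/
inductive Subtyping {E : Type u} [DecidableEq E] : Ty E → Ty E → Prop where
  | st_id (A : Ty E) : Subtyping A A
  | st_trans {A B C : Ty E} (h₁ : Subtyping A B) (h₂ : Subtyping B C) : Subtyping A C
  | st_arrow {A A' B B' : Ty E} (h₁ : Subtyping A' A) (h₂ : Subtyping B B') :
      Subtyping (arrow A B) (arrow A' B')
  | f_gen {A B : Ty E} (h : Subtyping A.shift B) : Subtyping A (all B)
  | f_inst (A B : Ty E) : Subtyping (all A) (A.inst B)
  | f_distr (A B : Ty E) : Subtyping (all (arrow A.shift B)) (arrow A (all B))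
  | ex_uni (A : Ty E) (Δ : Finset E) : Subtyping A (union A Δ)
  | ex_corrupt (A : Ty E) (Δ : Finset E) : Subtyping (union A Δ) (corrupt A Δ)
  | ex_noexc (A : Ty E) : Subtyping (corrupt A ∅) A
  | ex_ctx {A B : Ty E} (Δ : Finset E) (h : Subtyping A B) : Subtyping (union A Δ) (union B Δ)
  | ex_arru (A B : Ty E) (Δ : Finset E) : Subtyping (union (arrow A B) Δ) (arrow A (union B Δ))
  | ex_fallc (A : Ty E) (Δ : Finset E) : Subtyping (all (corrupt A Δ)) (corrupt (all A) Δ)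
  | ex_fallu (A : Ty E) (Δ : Finset E) : Subtyping (all (union A Δ)) (union (all A) Δ)
  | ex_lcor (A : Ty E) (Δ : Finset E) : Subtyping (list (corrupt A Δ)) (corrupt (list A) Δ)
  | ex_lctx {A B : Ty E} (h : Subtyping A B) : Subtyping (list A) (list B)
  | eq_uu (A : Ty E) (Δ Δ' : Finset E) : Subtyping (union (union A Δ) Δ') (union A (Δ ∪ Δ'))
  | eq_uu' (A : Ty E) (Δ Δ' : Finset E) : Subtyping (union A (Δ ∪ Δ')) (union (union A Δ) Δ')
  | eq_cc (A : Ty E) (Δ Δ' : Finset E) : Subtyping (corrupt (corrupt A Δ) Δ') (corrupt A (Δ ∪ Δ'))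
  | eq_cc' (A : Ty E) (Δ Δ' : Finset E) : Subtyping (corrupt A (Δ ∪ Δ')) (corrupt (corrupt A Δ) Δ')
  | eq_uc (A : Ty E) (Δ Δ' : Finset E) :
      Subtyping (corrupt (union A Δ) Δ') (union (corrupt A Δ') Δ)
  | eq_uc' (A : Ty E) (Δ Δ' : Finset E) :
      Subtyping (union (corrupt A Δ') Δ) (corrupt (union A Δ) Δ')
  | eq_arrc (A B : Ty E) (Δ : Finset E) :
      Subtyping (corrupt (arrow A B) Δ) (arrow (corrupt A Δ) (corrupt B Δ))
  | eq_arrc' (A B : Ty E) (Δ : Finset E) :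
      Subtyping (arrow (corrupt A Δ) (corrupt B Δ)) (corrupt (arrow A B) Δ)

/-! ### Typing -/

/-- Typing contexts: the entry at position `n` is the type of the term variable with index `n`. -/
abbrev Context (E : Type u) : Type u := List (Ty E)

/-- The type scheme of the recursion operator on natural numbers,
`∀α. α⊎Δ → (nat^Δ → α⊎Δ → α⊎Δ) → (nat^Δ)⊎Δ' → α⊎(Δ∪Δ')`. -/
def Ty.natrecTy {E : Type u} [DecidableEq E] (Δ Δ' : Finset E) : Ty E :=
  .all (.arrow (.union (.var 0) Δ)
    (.arrow
      (.arrow (.corrupt .nat Δ) (.arrow (.union (.var 0) Δ) (.union (.var 0) Δ)))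
      (.arrow (.union (.corrupt .nat Δ) Δ')
        (.union (.var 0) (Δ ∪ Δ')))))

/-- The type scheme of the recursion operator on lists,
`∀α. ∀β. α⊎Δ → (β^Δ → (list β)^Δ → α⊎Δ → α⊎Δ) → ((list β)^Δ)⊎Δ' → α⊎(Δ∪Δ')`
(`α` has index `1` and `β` has index `0`). -/
def Ty.foldrightTy {E : Type u} [DecidableEq E] (Δ Δ' : Finset E) : Ty E :=
  .all (.all (.arrow (.union (.var 1) Δ)
    (.arrow
      (.arrow (.corrupt (.var 0) Δ)
        (.arrow (.corrupt (.list (.var 0)) Δ)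
          (.arrow (.union (.var 1) Δ) (.union (.var 1) Δ))))
      (.arrow (.union (.corrupt (.list (.var 0)) Δ) Δ')
        (.union (.var 1) (Δ ∪ Δ'))))))

/-- The typing judgment `Γ ⊢ M : A`. -/
inductive Typing {E : Type u} [DecidableEq E] : Context E → Term E → Ty E → Prop where
  | ax {Γ : Context E} {n : ℕ} {A : Ty E} (h : Γ[n]? = some A) : Typing Γ (.var n) A
  | abs {Γ : Context E} {M : Term E} {A B : Ty E} (h : Typing (A :: Γ) M B) :
      Typing Γ (.lam M) (.arrow A B)
  | app {Γ : Context E} {M N : Term E} {A B : Ty E}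
      (h₁ : Typing Γ M (.arrow A B)) (h₂ : Typing Γ N A) : Typing Γ (.app M N) B
  | gen {Γ : Context E} {M : Term E} {A : Ty E} (h : Typing (Γ.map Ty.shift) M A) :
      Typing Γ M (.all A)
  | subs {Γ : Context E} {M : Term E} {A B : Ty E} (h₁ : Typing Γ M A) (h₂ : Subtyping A B) :
      Typing Γ M B
  | zero (Γ : Context E) : Typing Γ .zero .nat
  | succ (Γ : Context E) : Typing Γ .succ (.arrow .nat .nat)
  | natrec (Γ : Context E) (Δ Δ' : Finset E) : Typing Γ .natrec (Ty.natrecTy Δ Δ')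
  | nil (Γ : Context E) : Typing Γ .nil (.all (.list (.var 0)))
  | cons (Γ : Context E) :
      Typing Γ .cons (.all (.arrow (.var 0) (.arrow (.list (.var 0)) (.list (.var 0)))))
  | foldright (Γ : Context E) (Δ Δ' : Finset E) : Typing Γ .foldright (Ty.foldrightTy Δ Δ')
  | raise (Γ : Context E) (ε : E) : Typing Γ (.raise ε) (.all (.union (.var 0) {ε}))
  | tryWith {Γ : Context E} {M N : Term E} {A : Ty E} {ε : E}
      (h₁ : Typing Γ M (.union A {ε})) (h₂ : Typing Γ N A) : Typing Γ (.tryWith M ε N) A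

end Fx

/-!
The proof is a realizability argument. Evaluation is studied through *head reduction*
(`Term.HeadRed`), a deterministic call-by-name strategy contained in `Red`.

A type is interpreted by a `Candidate`: a family of sets of values indexed by a finite set `Δ` of
exception names, the exceptions that may be hidden anywhere inside the data. The family is monotone
in `Δ` and its member at `Δ` contains `raise ε` for `ε ∈ Δ`. The corruption type `A ^ Δ` is then a
mere change of index, `Δ' ↦ Δ ∪ Δ'`, whereas the union type `A ⊎ Δ` adds the values `raise ε` with
`ε ∈ Δ` to each member of the family. The arrow is interpreted as in Kripke models: a function must
behave well at all larger indices. This gives the monotonicity `A → B ≤ (A → B) ^ Δ` and the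
exchange law `(A → B) ^ Δ ≃ A ^ Δ → B ^ Δ` at the same time. Quantifiers are intersections over all
candidates; since head reduction is deterministic, a term that evaluates into each member of a
family of candidates evaluates into their intersection (`Candidate.realizes_all`).

Subtyping is then inclusion of candidates (`Subtyping.sound`), and a typed term, closed by
realizers of its context, realizes its type (`Typing.adequate`). In `Typing.adequate` only the
variables below a bound on the free variables need realizers: the types of a context, such
as `∀ α, α`, may have none, but a closed term needs none.
-/

namespace Fx

universe u

variable {E : Type u}

namespace Term

/-! ### Substitution and closed terms -/

/-- The substitution sending index `0` to `N` and index `n + 1` to `σ n`. -/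
def scons (N : Term E) (σ : ℕ → Term E) : ℕ → Term E
  | 0 => N
  | n + 1 => σ n

theorem subst_rename (M : Term E) (ξ : ℕ → ℕ) (σ : ℕ → Term E) :
    (M.rename ξ).subst σ = M.subst fun n => σ (ξ n) := by
  induction M generalizing ξ σ with
  | lam M ih =>
    simp only [rename, subst, ih, lam.injEq]
    congr 1
    funext n
    cases n <;> rfl
  | _ => simp_all [rename, subst]

theorem rename_rename (M : Term E) (ξ ζ : ℕ → ℕ) :
    (M.rename ξ).rename ζ = M.rename fun n => ζ (ξ n) := by
  induction M generalizing ξ ζ with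
  | lam M ih =>
    simp only [rename, ih, lam.injEq]
    congr 1
    funext n
    cases n <;> rfl
  | _ => simp_all [rename]

theorem rename_subst (M : Term E) (σ : ℕ → Term E) (ξ : ℕ → ℕ) :
    (M.subst σ).rename ξ = M.subst fun n => (σ n).rename ξ := by
  induction M generalizing σ ξ with
  | lam M ih =>
    simp only [rename, subst, ih, lam.injEq]
    congr 1
    funext n
    cases n with
    | zero => rfl
    | succ n => simp [up, rename_rename, upRen]
  | _ => simp_all [rename, subst]

theorem subst_subst (M : Term E) (σ τ : ℕ → Term E) :
    (M.subst σ).subst τ = M.subst fun n => (σ n).subst τ := by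
  induction M generalizing σ τ with
  | lam M ih =>
    simp only [subst, ih, lam.injEq]
    congr 1
    funext n
    cases n with
    | zero => rfl
    | succ n => simp [up, subst_rename, rename_subst]
  | _ => simp_all [subst]

theorem subst_var (M : Term E) : M.subst var = M := by
  induction M with
  | lam M ih =>
    have : up (var : ℕ → Term E) = var := by
      funext n
      cases n <;> rfl
    simp [subst, this, ih]
  | _ => simp_all [subst]

theorem inst_subst_up (M N : Term E) (σ : ℕ → Term E) :
    (M.subst (up σ)).inst N = M.subst (scons N σ) := by
  rw [inst, subst_subst]
  congr 1
  funext n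
  cases n with
  | zero => rfl
  | succ n =>
    rw [up, subst_rename]
    exact subst_var _

theorem ClosedAt.rename {M : Term E} {j k : ℕ} {ξ : ℕ → ℕ} (hM : M.ClosedAt k)
    (hξ : ∀ n < k, ξ n < j) : (M.rename ξ).ClosedAt j := by
  induction M generalizing j k ξ with
  | var n => exact hξ n hM
  | lam M ih =>
    refine ih (k := k + 1) hM fun n hn => ?_
    cases n with
    | zero => exact Nat.succ_pos j
    | succ n => exact Nat.succ_lt_succ (hξ n (Nat.lt_of_succ_lt_succ hn))
  | app M N ihM ihN => exact ⟨ihM hM.1 hξ, ihN hM.2 hξ⟩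
  | tryWith M ε N ihM ihN => exact ⟨ihM hM.1 hξ, ihN hM.2 hξ⟩
  | _ => trivial

theorem ClosedAt.subst {M : Term E} {j k : ℕ} {σ : ℕ → Term E} (hM : M.ClosedAt k)
    (hσ : ∀ n < k, (σ n).ClosedAt j) : (M.subst σ).ClosedAt j := by
  induction M generalizing j k σ with
  | var n => exact hσ n hM
  | lam M ih =>
    refine ih (k := k + 1) hM fun n hn => ?_
    cases n with
    | zero => exact Nat.succ_pos j
    | succ n =>
      exact (hσ n (Nat.lt_of_succ_lt_succ hn)).rename fun _ h => Nat.succ_lt_succ h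
  | app M N ihM ihN => exact ⟨ihM hM.1 hσ, ihN hM.2 hσ⟩
  | tryWith M ε N ihM ihN => exact ⟨ihM hM.1 hσ, ihN hM.2 hσ⟩
  | _ => trivial

theorem IsValue.closed {V : Term E} (h : IsValue V) : V.Closed := by
  obtain h | ⟨ε, rfl⟩ := h
  · exact h.1
  · trivial

/-! ### Head reduction -/

/-- Head reduction: a notion of reduction is applied at the root, or at the place whose value the
root is waiting for (the function of an application, the body of a handler, the last argument of a
recursor). -/
inductive HeadRed : Term E → Term E → Prop where
  | base {M M' : Term E} (h : Beta M M') : HeadRed M M'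
  | app_left {M M' : Term E} (N : Term E) (h : HeadRed M M') : HeadRed (app M N) (app M' N)
  | try_body {M M' : Term E} (ε : E) (N : Term E) (h : HeadRed M M') :
      HeadRed (tryWith M ε N) (tryWith M' ε N)
  | natrec_arg (X Y : Term E) {N N' : Term E} (h : HeadRed N N') :
      HeadRed (app (app (app natrec X) Y) N) (app (app (app natrec X) Y) N')
  | foldright_arg (X Y : Term E) {N N' : Term E} (h : HeadRed N N') :
      HeadRed (app (app (app foldright X) Y) N) (app (app (app foldright X) Y) N')

/-- The reflexive and transitive closure of head reduction. -/
def HeadReduces (M N : Term E) : Prop := Relation.ReflTransGen HeadRed M N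

theorem HeadRed.red {M N : Term E} (h : HeadRed M N) : Red M N := by
  induction h with
  | base h => exact .base h
  | app_left N _ ih => exact .app_left N ih
  | try_body ε N _ ih => exact .try_body ε N ih
  | natrec_arg X Y _ ih => exact .app_right _ ih
  | foldright_arg X Y _ ih => exact .app_right _ ih

theorem HeadReduces.reduces {M N : Term E} (h : HeadReduces M N) : Reduces M N :=
  Relation.ReflTransGen.mono (fun _ _ => HeadRed.red) _ _ h

theorem not_headRed_raise {ε : E} {N : Term E} : ¬ HeadRed (raise ε) N := by
  rintro (⟨⟨⟩⟩)

theorem RegularShape.not_headRed {V N : Term E} (hV : RegularShape V) : ¬ HeadRed V N := by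
  intro h
  cases hV <;> repeat' (first | (cases ‹HeadRed _ _›) | (cases ‹Beta _ _›))

theorem IsValue.not_headRed {V N : Term E} (hV : IsValue V) : ¬ HeadRed V N := by
  obtain h | ⟨ε, rfl⟩ := hV
  · exact h.2.not_headRed
  · exact not_headRed_raise

theorem Beta.eq_of_headRed {M N N' : Term E} (h : Beta M N) (h' : HeadRed M N') : N = N' := by
  cases h' with
  | base h' =>
    cases h <;> cases h' <;> first
      | rfl
      | contradiction
      | exact nomatch ‹IsRegularValue (raise _)›.2
  | app_left _ h' =>
    cases h with
    | beta => exact absurd h' (RegularShape.lam _).not_headRed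
    | raise_app => exact absurd h' not_headRed_raise
    | natrec_zero | natrec_succ | natrec_raise =>
      exact absurd h' (RegularShape.natrec₂ _ _).not_headRed
    | foldright_nil | foldright_cons | foldright_raise =>
      exact absurd h' (RegularShape.foldright₂ _ _).not_headRed
  | try_body _ _ h' =>
    cases h with
    | try_value _ _ _ hV => exact absurd h' hV.2.not_headRed
    | _ => exact absurd h' not_headRed_raise
  | natrec_arg X Y h' =>
    cases h with
    | natrec_zero => exact absurd h' RegularShape.zero.not_headRed
    | natrec_succ => exact absurd h' (RegularShape.succ₁ _).not_headRed
    | natrec_raise => exact absurd h' not_headRed_raise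
  | foldright_arg X Y h' =>
    cases h with
    | foldright_nil => exact absurd h' RegularShape.nil.not_headRed
    | foldright_cons => exact absurd h' (RegularShape.cons₂ _ _).not_headRed
    | foldright_raise => exact absurd h' not_headRed_raise

theorem HeadRed.deterministic {M N N' : Term E} (h : HeadRed M N) (h' : HeadRed M N') :
    N = N' := by
  induction h generalizing N' with
  | base h => exact h.eq_of_headRed h'
  | app_left _ h ih =>
    cases h' with
    | base h' => exact (h'.eq_of_headRed (.app_left _ h)).symm
    | app_left _ h' => rw [ih h']
    | natrec_arg => exact absurd h (RegularShape.natrec₂ _ _).not_headRed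
    | foldright_arg => exact absurd h (RegularShape.foldright₂ _ _).not_headRed
  | try_body ε N h ih =>
    cases h' with
    | base h' => exact (h'.eq_of_headRed (.try_body _ _ h)).symm
    | try_body _ _ h' => rw [ih h']
  | natrec_arg X Y h ih =>
    cases h' with
    | base h' => exact (h'.eq_of_headRed (.natrec_arg _ _ h)).symm
    | app_left _ h' => exact absurd h' (RegularShape.natrec₂ _ _).not_headRed
    | natrec_arg _ _ h' => rw [ih h']
  | foldright_arg X Y h ih =>
    cases h' with
    | base h' => exact (h'.eq_of_headRed (.foldright_arg _ _ h)).symm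
    | app_left _ h' => exact absurd h' (RegularShape.foldright₂ _ _).not_headRed
    | foldright_arg _ _ h' => rw [ih h']

theorem HeadReduces.value_unique {M V W : Term E} (hV : IsValue V) (hW : IsValue W)
    (h : HeadReduces M V) (h' : HeadReduces M W) : V = W := by
  have normal {V W : Term E} (hV : IsValue V) (h : HeadReduces V W) : V = W := by
    obtain h | ⟨_, h, _⟩ := Relation.ReflTransGen.cases_head h
    · exact h
    · exact absurd h hV.not_headRed
  obtain h | h := Relation.ReflTransGen.total_of_right_unique
    (fun _ _ _ h₁ h₂ => h₁.deterministic h₂) h h'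
  · exact normal hV h
  · exact (normal hW h).symm

theorem HeadReduces.of_beta {M N : Term E} (h : Beta M N) : HeadReduces M N :=
  Relation.ReflTransGen.single (.base h)

theorem HeadReduces.trans {M N P : Term E} (h : HeadReduces M N) (h' : HeadReduces N P) :
    HeadReduces M P :=
  Relation.ReflTransGen.trans h h'

theorem HeadReduces.app_left {M M' : Term E} (h : HeadReduces M M') (N : Term E) :
    HeadReduces (app M N) (app M' N) :=
  Relation.ReflTransGen.lift (app · N) (fun _ _ => HeadRed.app_left N) _ _ h

theorem HeadReduces.try_body {M M' : Term E} (h : HeadReduces M M') (ε : E) (N : Term E) :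
    HeadReduces (tryWith M ε N) (tryWith M' ε N) :=
  Relation.ReflTransGen.lift (tryWith · ε N) (fun _ _ => HeadRed.try_body ε N) _ _ h

theorem HeadReduces.natrec_arg {N N' : Term E} (h : HeadReduces N N') (X Y : Term E) :
    HeadReduces (app (app (app natrec X) Y) N) (app (app (app natrec X) Y) N') :=
  Relation.ReflTransGen.lift (app (app (app natrec X) Y)) (fun _ _ => HeadRed.natrec_arg X Y) _ _ h

theorem HeadReduces.foldright_arg {N N' : Term E} (h : HeadReduces N N') (X Y : Term E) :
    HeadReduces (app (app (app foldright X) Y) N) (app (app (app foldright X) Y) N') :=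
  Relation.ReflTransGen.lift (app (app (app foldright X) Y)) (fun _ _ => HeadRed.foldright_arg X Y) _ _ h

end Term

open Term

/-! ### Candidates -/

/-- A candidate: a monotone family of sets of values indexed by finite sets of exception names. The
set at `Δ` consists of the values of the type when the exceptions of `Δ` may occur anywhere in
them; in particular they may be such an exception themselves. -/
@[ext]
structure Candidate (E : Type u) : Type u where
  /-- `Val Δ V`: the value `V` belongs to the candidate at index `Δ`. -/
  Val : Finset E → Term E → Prop
  isValue {Δ : Finset E} {V : Term E} : Val Δ V → IsValue V
  mono {Δ Δ' : Finset E} {V : Term E} : Δ ⊆ Δ' → Val Δ V → Val Δ' V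
  raise {Δ : Finset E} {ε : E} : ε ∈ Δ → Val Δ (raise ε)

namespace Candidate

/-- A term realizes a candidate at index `Δ` if it is closed and head reduces to a value of the
candidate. -/
def Realizes (F : Candidate E) (Δ : Finset E) (M : Term E) : Prop :=
  M.Closed ∧ ∃ V, F.Val Δ V ∧ HeadReduces M V

theorem Val.realizes {F : Candidate E} {Δ : Finset E} {V : Term E} (h : F.Val Δ V) :
    F.Realizes Δ V :=
  ⟨(F.isValue h).closed, V, h, .refl⟩

theorem Realizes.expand {F : Candidate E} {Δ : Finset E} {M N : Term E} (h : F.Realizes Δ N)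
    (hM : M.Closed) (hMN : HeadReduces M N) : F.Realizes Δ M := by
  obtain ⟨_, V, hV, hN⟩ := h
  exact ⟨hM, V, hV, hMN.trans hN⟩

theorem Realizes.imp {F G : Candidate E} {Δ Δ' : Finset E} {M : Term E} (h : F.Realizes Δ M)
    (hFG : ∀ V, F.Val Δ V → G.Val Δ' V) : G.Realizes Δ' M := by
  obtain ⟨hM, V, hV, hMV⟩ := h
  exact ⟨hM, V, hFG V hV, hMV⟩

theorem Realizes.mono {F : Candidate E} {Δ Δ' : Finset E} {M : Term E} (h : F.Realizes Δ M)
    (hΔ : Δ ⊆ Δ') : F.Realizes Δ' M :=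
  h.imp fun _ => F.mono hΔ

/-- The values of type `nat` at index `Δ`. -/
inductive NatVal (Δ : Finset E) : Term E → Prop where
  | zero : NatVal Δ zero
  | succ {N V : Term E} (hN : N.Closed) (hV : NatVal Δ V) (h : HeadReduces N V) :
      NatVal Δ (app succ N)
  | raise {ε : E} (h : ε ∈ Δ) : NatVal Δ (Term.raise ε)

/-- The interpretation of `nat`. -/
def nat : Candidate E where
  Val := NatVal
  isValue h := by
    cases h with
    | zero => exact .inl ⟨trivial, .zero⟩
    | succ hN => exact .inl ⟨⟨trivial, hN⟩, .succ₁ _⟩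
    | raise => exact .inr ⟨_, rfl⟩
  mono hΔ h := by
    induction h with
    | zero => exact .zero
    | succ hN _ h ih => exact .succ hN ih h
    | raise h => exact .raise (hΔ h)
  raise := .raise

/-- The values of the type of lists over `F` at index `Δ`. -/
inductive ListVal (F : Candidate E) (Δ : Finset E) : Term E → Prop where
  | nil : ListVal F Δ nil
  | cons {H L V : Term E} (hH : F.Realizes Δ H) (hL : L.Closed) (hV : ListVal F Δ V)
      (h : HeadReduces L V) : ListVal F Δ (app (app cons H) L)
  | raise {ε : E} (h : ε ∈ Δ) : ListVal F Δ (Term.raise ε)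

theorem ListVal.imp {F G : Candidate E} {Δ Δ' : Finset E} {V : Term E} (h : ListVal F Δ V)
    (hΔ : Δ ⊆ Δ') (hFG : ∀ V, F.Val Δ V → G.Val Δ' V) : ListVal G Δ' V := by
  induction h with
  | nil => exact .nil
  | cons hH hL _ h ih => exact .cons (hH.imp hFG) hL ih h
  | raise h => exact .raise (hΔ h)

/-- The interpretation of `list`. -/
def list (F : Candidate E) : Candidate E where
  Val := ListVal F
  isValue h := by
    cases h with
    | nil => exact .inl ⟨trivial, .nil⟩
    | cons hH hL => exact .inl ⟨⟨⟨trivial, hH.1⟩, hL⟩, .cons₂ _ _⟩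
    | raise => exact .inr ⟨_, rfl⟩
  mono hΔ h := h.imp hΔ fun _ => F.mono hΔ
  raise := .raise

/-- The interpretation of the arrow: the values that send realizers to realizers at all larger
indices. -/
def arrow (F G : Candidate E) : Candidate E where
  Val Δ V := IsValue V ∧ ∀ Δ', Δ ⊆ Δ' → ∀ N, F.Realizes Δ' N → G.Realizes Δ' (app V N)
  isValue h := h.1
  mono hΔ h := ⟨h.1, fun Δ' hΔ' => h.2 Δ' (hΔ.trans hΔ')⟩
  raise {_ ε} h := ⟨.inr ⟨ε, rfl⟩, fun _ hΔ' N hN =>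
    (Val.realizes (G.raise (hΔ' h))).expand ⟨trivial, hN.1⟩ (.of_beta (.raise_app ε N))⟩

/-- The candidate of all values. It also makes the intersections in `all` range over a nonempty
type, so that their elements are values. -/
instance : Inhabited (Candidate E) where
  default :=
    { Val := fun _ => IsValue
      isValue := id
      mono := fun _ => id
      raise := fun _ => .inr ⟨_, rfl⟩ }

/-- The interpretation of the quantifier: the intersection of a family indexed by candidates. -/
def all (G : Candidate E → Candidate E) : Candidate E where
  Val Δ V := ∀ F, (G F).Val Δ V
  isValue h := (G default).isValue (h default)
  mono hΔ h F := (G F).mono hΔ (h F)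
  raise h F := (G F).raise h

/-- The interpretation of the union type: the exceptions of `Δ` are added as values. -/
def union (F : Candidate E) (Δ : Finset E) : Candidate E where
  Val Δ' V := F.Val Δ' V ∨ ∃ ε ∈ Δ, V = Term.raise ε
  isValue h := by
    obtain h | ⟨ε, _, rfl⟩ := h
    · exact F.isValue h
    · exact .inr ⟨ε, rfl⟩
  mono hΔ h := h.imp_left (F.mono hΔ)
  raise h := .inl (F.raise h)

/-- The interpretation of the corruption type: a change of index. -/
def corrupt [DecidableEq E] (F : Candidate E) (Δ : Finset E) : Candidate E where
  Val Δ' V := F.Val (Δ ∪ Δ') V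
  isValue := F.isValue
  mono hΔ := F.mono (Finset.union_subset_union_right hΔ)
  raise h := F.raise (Finset.mem_union_right _ h)

/-- Realizability commutes with intersections: by determinism of head reduction, the value reached
by a term does not depend on the candidate. -/
theorem realizes_all {G : Candidate E → Candidate E} {Δ : Finset E} {M : Term E}
    (h : ∀ F, (G F).Realizes Δ M) : (all G).Realizes Δ M := by
  obtain ⟨hM, V, hV, hMV⟩ := h default
  refine ⟨hM, V, fun F => ?_, hMV⟩
  obtain ⟨_, W, hW, hMW⟩ := h F
  rwa [hMV.value_unique ((G _).isValue hV) ((G F).isValue hW) hMW]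

theorem val_union_mono {F : Candidate E} {Δ Δ' Δ₀ : Finset E} (hΔ : Δ ⊆ Δ') (V : Term E)
    (h : (F.union Δ).Val Δ₀ V) : (F.union Δ').Val Δ₀ V :=
  Or.imp_right (fun ⟨ε, hε, hV⟩ => ⟨ε, hΔ hε, hV⟩) h

theorem Realizes.app {F G : Candidate E} {Δ : Finset E} {M N : Term E}
    (hM : (arrow F G).Realizes Δ M) (hN : F.Realizes Δ N) : G.Realizes Δ (app M N) := by
  obtain ⟨hM, V, hV, hMV⟩ := hM
  exact (hV.2 Δ subset_rfl N hN).expand ⟨hM, hN.1⟩ (hMV.app_left N)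

theorem Realizes.tryWith {F : Candidate E} {Δ : Finset E} {M N : Term E} {ε : E}
    (hM : (F.union {ε}).Realizes Δ M) (hN : F.Realizes Δ N) :
    F.Realizes Δ (tryWith M ε N) := by
  obtain ⟨hMc, V, hV, hMV⟩ := hM
  have red : HeadReduces (.tryWith M ε N) (.tryWith V ε N) := hMV.try_body ε N
  have catch_ (h : V = Term.raise ε) : F.Realizes Δ (.tryWith M ε N) := by
    subst h
    exact hN.expand ⟨hMc, hN.1⟩ (red.trans (.of_beta (.try_catch ε N)))
  obtain hV | ⟨ε', hε', hV⟩ := hV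
  · obtain hreg | ⟨ε', hε'⟩ := F.isValue hV
    · exact hV.realizes.expand ⟨hMc, hN.1⟩ (red.trans (.of_beta (.try_value ε V N hreg)))
    · by_cases hne : ε = ε'
      · exact catch_ (hne ▸ hε')
      · subst hε'
        exact hV.realizes.expand ⟨hMc, hN.1⟩ (red.trans (.of_beta (.try_raise ε ε' N hne)))
  · rw [Finset.mem_singleton] at hε'
    exact catch_ (hε' ▸ hV)

/-! ### The recursors -/

section Recursors

variable [DecidableEq E]

/-- Recursion on a corrupted natural number. An exception in the number comes from `Δ`, hence is
allowed by the union type, or from the index `Δ₀`, hence belongs to `F`. -/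
theorem natrec_realizes {F : Candidate E} {Δ Δ₀ : Finset E} {X Y V : Term E}
    (hX : (F.union Δ).Realizes Δ₀ X)
    (hY : (arrow (nat.corrupt Δ) (arrow (F.union Δ) (F.union Δ))).Realizes Δ₀ Y)
    (hV : NatVal (Δ ∪ Δ₀) V) :
    (F.union Δ).Realizes Δ₀ (Term.app (.app (.app .natrec X) Y) V) := by
  induction hV with
  | zero => exact hX.expand ⟨⟨⟨trivial, hX.1⟩, hY.1⟩, trivial⟩ (.of_beta (.natrec_zero X Y))
  | @succ N V hN hV h ih =>
    have rec_ := ih.expand (M := .app (.app (.app .natrec X) Y) N) ⟨⟨⟨trivial, hX.1⟩, hY.1⟩, hN⟩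
      (h.natrec_arg X Y)
    exact ((hY.app ⟨hN, V, hV, h⟩).app rec_).expand ⟨⟨⟨trivial, hX.1⟩, hY.1⟩, trivial, hN⟩
      (.of_beta (.natrec_succ X Y N))
  | @raise ε hε =>
    have hr : (F.union Δ).Val Δ₀ (.raise ε) := (Finset.mem_union.1 hε).elim
      (fun hε => .inr ⟨ε, hε, rfl⟩) (fun hε => .inl (F.raise hε))
    exact hr.realizes.expand ⟨⟨⟨trivial, hX.1⟩, hY.1⟩, trivial⟩ (.of_beta (.natrec_raise X Y ε))

/-- Recursion on a corrupted list; exceptions are treated as in `natrec_realizes`. -/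
theorem foldright_realizes {F G : Candidate E} {Δ Δ₀ : Finset E} {X Y V : Term E}
    (hX : (F.union Δ).Realizes Δ₀ X)
    (hY : (arrow (G.corrupt Δ) (arrow (G.list.corrupt Δ)
      (arrow (F.union Δ) (F.union Δ)))).Realizes Δ₀ Y)
    (hV : ListVal G (Δ ∪ Δ₀) V) :
    (F.union Δ).Realizes Δ₀ (Term.app (.app (.app .foldright X) Y) V) := by
  induction hV with
  | nil => exact hX.expand ⟨⟨⟨trivial, hX.1⟩, hY.1⟩, trivial⟩ (.of_beta (.foldright_nil X Y))
  | @cons H L V hH hL hV h ih =>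
    have rec_ := ih.expand (M := .app (.app (.app .foldright X) Y) L)
      ⟨⟨⟨trivial, hX.1⟩, hY.1⟩, hL⟩ (h.foldright_arg X Y)
    exact (((hY.app hH).app ⟨hL, V, hV, h⟩).app rec_).expand
      ⟨⟨⟨trivial, hX.1⟩, hY.1⟩, ⟨trivial, hH.1⟩, hL⟩ (.of_beta (.foldright_cons X Y H L))
  | @raise ε hε =>
    have hr : (F.union Δ).Val Δ₀ (.raise ε) := (Finset.mem_union.1 hε).elim
      (fun hε => .inr ⟨ε, hε, rfl⟩) (fun hε => .inl (F.raise hε))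
    exact hr.realizes.expand ⟨⟨⟨trivial, hX.1⟩, hY.1⟩, trivial⟩
      (.of_beta (.foldright_raise X Y ε))

theorem natrec_val (F : Candidate E) (Δ Δ' Δ₀ : Finset E) :
    (arrow (F.union Δ) (arrow (arrow (nat.corrupt Δ) (arrow (F.union Δ) (F.union Δ)))
      (arrow ((nat.corrupt Δ).union Δ') (F.union (Δ ∪ Δ'))))).Val Δ₀ natrec := by
  refine ⟨.inl ⟨trivial, .natrec⟩, fun Δ₁ _ X hX => Val.realizes ?_⟩
  refine ⟨.inl ⟨⟨trivial, hX.1⟩, .natrec₁ X⟩, fun Δ₂ h₂ Y hY => Val.realizes ?_⟩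
  refine ⟨.inl ⟨⟨⟨trivial, hX.1⟩, hY.1⟩, .natrec₂ X Y⟩, fun Δ₃ h₃ N hN => ?_⟩
  obtain ⟨hN, V, hV, hNV⟩ := hN
  have closed {N : Term E} (hN : N.Closed) : (Term.app (.app (.app .natrec X) Y) N).Closed :=
    ⟨⟨⟨trivial, hX.1⟩, hY.1⟩, hN⟩
  refine Realizes.expand (N := .app (.app (.app .natrec X) Y) V) ?_ (closed hN)
    (hNV.natrec_arg X Y)
  obtain hV | ⟨ε, hε, rfl⟩ := hV
  · exact (natrec_realizes (hX.mono (h₂.trans h₃)) (hY.mono h₃) hV).imp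
      (val_union_mono Finset.subset_union_left)
  · have hr : (F.union (Δ ∪ Δ')).Val Δ₃ (.raise ε) :=
      .inr ⟨ε, Finset.mem_union_right _ hε, rfl⟩
    exact hr.realizes.expand (closed trivial) (.of_beta (.natrec_raise X Y ε))

theorem foldright_val (F G : Candidate E) (Δ Δ' Δ₀ : Finset E) :
    (arrow (F.union Δ) (arrow (arrow (G.corrupt Δ) (arrow (G.list.corrupt Δ)
      (arrow (F.union Δ) (F.union Δ))))
      (arrow ((G.list.corrupt Δ).union Δ') (F.union (Δ ∪ Δ'))))).Val Δ₀ foldright := by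
  refine ⟨.inl ⟨trivial, .foldright⟩, fun Δ₁ _ X hX => Val.realizes ?_⟩
  refine ⟨.inl ⟨⟨trivial, hX.1⟩, .foldright₁ X⟩, fun Δ₂ h₂ Y hY => Val.realizes ?_⟩
  refine ⟨.inl ⟨⟨⟨trivial, hX.1⟩, hY.1⟩, .foldright₂ X Y⟩, fun Δ₃ h₃ N hN => ?_⟩
  obtain ⟨hN, V, hV, hNV⟩ := hN
  have closed {N : Term E} (hN : N.Closed) :
      (Term.app (.app (.app .foldright X) Y) N).Closed :=
    ⟨⟨⟨trivial, hX.1⟩, hY.1⟩, hN⟩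
  refine Realizes.expand (N := .app (.app (.app .foldright X) Y) V) ?_ (closed hN)
    (hNV.foldright_arg X Y)
  obtain hV | ⟨ε, hε, rfl⟩ := hV
  · exact (foldright_realizes (hX.mono (h₂.trans h₃)) (hY.mono h₃) hV).imp
      (val_union_mono Finset.subset_union_left)
  · have hr : (F.union (Δ ∪ Δ')).Val Δ₃ (.raise ε) :=
      .inr ⟨ε, Finset.mem_union_right _ hε, rfl⟩
    exact hr.realizes.expand (closed trivial) (.of_beta (.foldright_raise X Y ε))

end Recursors

end Candidate

/-! ### Interpretation of types -/

section Interpretation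

variable [DecidableEq E]

/-- The valuation sending index `0` to `F` and index `n + 1` to `ρ n`. -/
def extend (F : Candidate E) (ρ : ℕ → Candidate E) : ℕ → Candidate E
  | 0 => F
  | n + 1 => ρ n

namespace Ty

/-- The interpretation of a type under a valuation of its free variables. -/
def interp : Ty E → (ℕ → Candidate E) → Candidate E
  | var n, ρ => ρ n
  | nat, _ => .nat
  | list A, ρ => (A.interp ρ).list
  | arrow A B, ρ => (A.interp ρ).arrow (B.interp ρ)
  | all A, ρ => .all fun F => A.interp (extend F ρ)
  | union A Δ, ρ => (A.interp ρ).union Δ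
  | corrupt A Δ, ρ => (A.interp ρ).corrupt Δ

theorem interp_rename (A : Ty E) (ξ : ℕ → ℕ) (ρ : ℕ → Candidate E) :
    (A.rename ξ).interp ρ = A.interp fun n => ρ (ξ n) := by
  induction A generalizing ξ ρ with
  | all A ih =>
    simp only [rename, interp, ih]
    congr 1
    funext F
    congr 1
    funext n
    cases n <;> rfl
  | _ => simp_all [rename, interp]

theorem interp_shift (A : Ty E) (F : Candidate E) (ρ : ℕ → Candidate E) :
    A.shift.interp (extend F ρ) = A.interp ρ :=
  A.interp_rename Nat.succ (extend F ρ)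

theorem interp_subst (A : Ty E) (σ : ℕ → Ty E) (ρ : ℕ → Candidate E) :
    (A.subst σ).interp ρ = A.interp fun n => (σ n).interp ρ := by
  induction A generalizing σ ρ with
  | all A ih =>
    simp only [subst, interp, ih]
    congr 1
    funext F
    congr 1
    funext n
    cases n with
    | zero => rfl
    | succ n => exact interp_shift _ _ _
  | _ => simp_all [subst, interp]

theorem interp_inst (A B : Ty E) (ρ : ℕ → Candidate E) :
    (A.inst B).interp ρ = A.interp (extend (B.interp ρ) ρ) := by
  rw [inst, interp_subst]
  congr 1
  funext n
  cases n <;> rfl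

end Ty

/-! ### Soundness of subtyping -/

theorem Subtyping.sound {A B : Ty E} (h : Subtyping A B) (ρ : ℕ → Candidate E) (Δ₀ : Finset E)
    (V : Term E) (hV : (A.interp ρ).Val Δ₀ V) : (B.interp ρ).Val Δ₀ V := by
  induction h generalizing ρ Δ₀ V with
  | st_id A => exact hV
  | st_trans _ _ ih₁ ih₂ => exact ih₂ _ _ _ (ih₁ _ _ _ hV)
  | st_arrow _ _ ih₁ ih₂ =>
    exact ⟨hV.1, fun Δ' hΔ' N hN => (hV.2 Δ' hΔ' N (hN.imp (ih₁ ρ Δ'))).imp (ih₂ ρ Δ')⟩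
  | @f_gen A B _ ih =>
    intro F
    refine ih _ _ _ ?_
    rwa [A.interp_shift]
  | f_inst A B =>
    rw [A.interp_inst]
    exact hV _
  | f_distr A B =>
    refine ⟨(hV default).1, fun Δ' hΔ' N hN => Candidate.realizes_all fun F => ?_⟩
    refine (hV F).2 Δ' hΔ' N ?_
    rwa [A.interp_shift]
  | ex_uni A Δ => exact .inl hV
  | ex_corrupt A Δ =>
    obtain hV | ⟨ε, hε, rfl⟩ := hV
    · exact (A.interp ρ).mono Finset.subset_union_right hV
    · exact (A.interp ρ).raise (Finset.mem_union_left _ hε)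
  | ex_noexc A => exact (A.interp ρ).mono (Finset.empty_union Δ₀).subset hV
  | ex_ctx Δ _ ih => exact Or.imp_left (ih ρ Δ₀ V) hV
  | ex_arru A B Δ =>
    obtain hV | ⟨ε, hε, rfl⟩ := hV
    · exact ⟨hV.1, fun Δ' hΔ' N hN => (hV.2 Δ' hΔ' N hN).imp fun _ => .inl⟩
    · refine ⟨.inr ⟨ε, rfl⟩, fun Δ' _ N hN => ?_⟩
      have hr : ((B.union Δ).interp ρ).Val Δ' (raise ε) := .inr ⟨ε, hε, rfl⟩
      exact hr.realizes.expand ⟨trivial, hN.1⟩ (.of_beta (.raise_app ε N))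
  | ex_fallc A Δ => exact hV
  | ex_fallu A Δ =>
    by_cases h : ∃ ε ∈ Δ, V = raise ε
    · exact .inr h
    · exact .inl fun F => (hV F).resolve_right h
  | ex_lcor A Δ => exact Candidate.ListVal.imp hV Finset.subset_union_right fun _ => id
  | ex_lctx _ ih => exact Candidate.ListVal.imp hV subset_rfl (ih ρ Δ₀)
  | eq_uu A Δ Δ' =>
    obtain (hV | ⟨ε, hε, rfl⟩) | ⟨ε, hε, rfl⟩ := hV
    · exact .inl hV
    · exact .inr ⟨ε, Finset.mem_union_left _ hε, rfl⟩
    · exact .inr ⟨ε, Finset.mem_union_right _ hε, rfl⟩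
  | eq_uu' A Δ Δ' =>
    obtain hV | ⟨ε, hε, rfl⟩ := hV
    · exact .inl (.inl hV)
    · obtain hε | hε := Finset.mem_union.1 hε
      · exact .inl (.inr ⟨ε, hε, rfl⟩)
      · exact .inr ⟨ε, hε, rfl⟩
  | eq_cc A Δ Δ' => exact (A.interp ρ).mono (Finset.union_assoc Δ Δ' Δ₀).superset hV
  | eq_cc' A Δ Δ' => exact (A.interp ρ).mono (Finset.union_assoc Δ Δ' Δ₀).subset hV
  | eq_uc A Δ Δ' => exact hV
  | eq_uc' A Δ Δ' => exact hV
  | eq_arrc A B Δ =>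
    exact ⟨hV.1, fun Δ' hΔ' => hV.2 (Δ ∪ Δ') (Finset.union_subset_union_right hΔ')⟩
  | eq_arrc' A B Δ =>
    refine ⟨hV.1, fun Δ' hΔ' N hN => ?_⟩
    -- `Δ'` contains `Δ`, so corruption by `Δ` leaves this index unchanged.
    have hΔ : Δ ∪ Δ' = Δ' := Finset.union_eq_right.2 (Finset.union_subset_left hΔ')
    have key : ∀ N, (A.interp ρ).Realizes (Δ ∪ Δ') N → (B.interp ρ).Realizes (Δ ∪ Δ') (app V N) :=
      hV.2 Δ' (Finset.union_subset_right hΔ')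
    rw [hΔ] at key
    exact key N hN

/-! ### Adequacy -/

/-- A well-typed term realizes its type once its variables are replaced by realizers of theirs. The
number `k` bounds the free variables of the term, and only indices below `k` need realizers. -/
theorem Typing.adequate {Γ : Context E} {M : Term E} {A : Ty E} (h : Typing Γ M A)
    (ρ : ℕ → Candidate E) (Δ₀ : Finset E) {k : ℕ} {σ : ℕ → Term E} (hM : M.ClosedAt k)
    (hσ : ∀ n < k, ∃ B, Γ[n]? = some B ∧ (B.interp ρ).Realizes Δ₀ (σ n)) :
    (A.interp ρ).Realizes Δ₀ (M.subst σ) := by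
  induction h generalizing ρ Δ₀ k σ with
  | ax h =>
    obtain ⟨B, hB, hn⟩ := hσ _ hM
    rw [h, Option.some_inj] at hB
    exact hB ▸ hn
  | @abs Γ M A B _ ih =>
    have closed : (Term.lam (M.subst (up σ))).Closed :=
      ClosedAt.subst (M := .lam M) hM fun n hn => by
        obtain ⟨_, _, hn⟩ := hσ n hn
        exact hn.1
    refine Candidate.Val.realizes
      ⟨.inl ⟨closed, .lam _⟩, fun Δ' hΔ' N hN => Candidate.Realizes.expand ?_ ⟨closed, hN.1⟩
        (.of_beta (.beta _ _))⟩
    rw [inst_subst_up]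
    refine ih ρ Δ' (k := k + 1) hM fun n hn => ?_
    cases n with
    | zero => exact ⟨A, rfl, hN⟩
    | succ n =>
      obtain ⟨B, hB, hn⟩ := hσ n (Nat.lt_of_succ_lt_succ hn)
      exact ⟨B, hB, hn.mono hΔ'⟩
  | app _ _ ih₁ ih₂ => exact (ih₁ ρ Δ₀ hM.1 hσ).app (ih₂ ρ Δ₀ hM.2 hσ)
  | gen _ ih =>
    refine Candidate.realizes_all fun F => ih (extend F ρ) Δ₀ hM fun n hn => ?_
    obtain ⟨B, hB, hn⟩ := hσ n hn
    refine ⟨B.shift, by simp [hB], ?_⟩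
    rwa [B.interp_shift]
  | subs _ h ih => exact (ih ρ Δ₀ hM hσ).imp (h.sound ρ Δ₀)
  | zero => exact Candidate.Val.realizes (F := .nat) Candidate.NatVal.zero
  | succ =>
    refine Candidate.Val.realizes ⟨.inl ⟨trivial, .succ⟩, fun Δ' _ N hN => ?_⟩
    obtain ⟨hN, V, hV, hNV⟩ := hN
    exact Candidate.Val.realizes (F := .nat) (Candidate.NatVal.succ hN hV hNV)
  | natrec Γ Δ Δ' => exact Candidate.Val.realizes fun F => Candidate.natrec_val F Δ Δ' Δ₀
  | nil => exact Candidate.Val.realizes fun F => Candidate.ListVal.nil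
  | cons =>
    refine Candidate.Val.realizes fun F => ?_
    refine ⟨.inl ⟨trivial, .cons⟩, fun Δ' _ H hH => Candidate.Val.realizes ?_⟩
    refine ⟨.inl ⟨⟨trivial, hH.1⟩, .cons₁ H⟩, fun Δ'' hΔ'' L hL => ?_⟩
    obtain ⟨hL, V, hV, hLV⟩ := hL
    exact Candidate.Val.realizes (F := F.list) (Candidate.ListVal.cons (hH.mono hΔ'') hL hV hLV)
  | foldright Γ Δ Δ' =>
    exact Candidate.Val.realizes fun F G => Candidate.foldright_val F G Δ Δ' Δ₀
  | raise Γ ε =>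
    exact Candidate.Val.realizes fun F => .inr ⟨ε, Finset.mem_singleton_self ε, rfl⟩
  | tryWith _ _ ih₁ ih₂ => exact (ih₁ ρ Δ₀ hM.1 hσ).tryWith (ih₂ ρ Δ₀ hM.2 hσ)

end Interpretation

end Fx

theorem mainTheorem2 {E : Type*} [Countable E] [DecidableEq E]
    (Γ : Fx.Context E) (M : Fx.Term E) (A : Fx.Ty E)
    (hM : M.Closed) (h : Fx.Typing Γ M A) : M.HasValue := by
  obtain ⟨_, V, hV, hMV⟩ := h.adequate (fun _ => default) ∅ (σ := Fx.Term.var) hM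
    fun n hn => absurd hn (Nat.not_lt_zero n)
  rw [M.subst_var] at hMV
  exact ⟨V, Fx.Candidate.isValue _ hV, hMV.reduces⟩
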